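/- Let $K \subseteq L$ be commutative fields such that every element of $L$ that is algebraic over $K$ is separable over $K$. For subsets $S_1,\dots,S_n$ of $L$, let $\langle S_1\cdots S_n\rangle$ denote the $K$-subspace of $L$ spanned by the product set $S_1\cdots S_n=\{s_1\cdots s_n \mid s_i\in S_i\}$. Let $A,B,C\subseteq L$ be finite-dimensional $K$-subspaces of $L$ such that $A\neq\{0\}$, $B\neq\{0\}$ and $1\in C$ (equivalently, $K\subseteq C$). Then $$\langle ABC\rangle=\langle AB\rangle \quad\text{or}\quad \dim_K\langle ABC\rangle\ \ge\ \dim_K A+\dim_K B .$$ -/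

import Mathlib

open scoped Pointwise

/-!
Write `AB` for the product of subspaces. The key fact is `exists_field_stable_between`: for every
nonzero `a ∈ A` there are an intermediate field `H` and an `H`-stable subspace `D` with
`aB ⊆ D ⊆ AB` and `dim A + dim B ≤ dim D + dim H`. It is proved by induction on `dim A`, using the
linear Dyson transform: for `e` with `ae ∈ B`, the pair `A(e) = {x ∈ A | xe ∈ B}`, `B(e) = B + Ae`
has the same sum of dimensions, `a ∈ A(e)`, `B ⊆ B(e)`, and `A(e)B(e) ⊆ AB`. If no transform shrinks
`A`, then `a⁻¹A` stabilises `B`, and `D = aB` works together with the field `H` of all elements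
stabilising `B`.

If `ABC ≠ AB`, then `aBC ⊄ AB` for some `a ∈ A`. For the corresponding `H` and `D`, the subspace `DC`
is `H`-stable and contains `D`, because `1 ∈ C`; it contains `aBC`, so it is not contained in `D`.
Since `H` is a field, a strict inclusion of `H`-stable subspaces costs at least `dim H` dimensions
(`finrank_add_finrank_le_of_stable`), so `dim ABC ≥ dim DC ≥ dim D + dim H ≥ dim A + dim B`.
-/

open Module

section

variable {K L : Type*} [Field K] [Field L] [Algebra K L]

theorem LinearMap.mulRight_injective_of_ne_zero {e : L} (he : e ≠ 0) :
    Function.Injective (LinearMap.mulRight K e) :=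
  fun _ _ h => mul_right_cancel₀ he h

/-- The elements of `L` that map a finite-dimensional subspace `B` into itself. Finite dimension
makes multiplication by a nonzero such element surjective on `B`, which gives closure under
inverses. -/
def Submodule.stabilizerField (B : Submodule K L) [FiniteDimensional K B] :
    IntermediateField K L where
  carrier := {x | ∀ b ∈ B, x * b ∈ B}
  mul_mem' := fun {x y} hx hy b hb => by
    rw [mul_assoc]; exact hx _ (hy _ hb)
  add_mem' := fun {x y} hx hy b hb => by
    rw [add_mul]; exact B.add_mem (hx _ hb) (hy _ hb)
  algebraMap_mem' := fun k b hb => by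
    rw [← Algebra.smul_def]; exact B.smul_mem k hb
  inv_mem' := fun x hx b hb => by
    rcases eq_or_ne x 0 with rfl | h0
    · simp
    · have hle : B.map (LinearMap.mulRight K x) ≤ B := by
        rintro _ ⟨c, hc, rfl⟩
        simpa [mul_comm] using hx c hc
      have heq : B.map (LinearMap.mulRight K x) = B :=
        Submodule.eq_of_le_of_finrank_eq hle
          (Submodule.equivMapOfInjective _
            (LinearMap.mulRight_injective_of_ne_zero h0) B).finrank_eq.symm
      rw [← heq] at hb
      obtain ⟨c, hc, rfl⟩ := hb
      have : x⁻¹ * (c * x) = c := by field_simp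
      simpa [this] using hc

theorem Submodule.mem_stabilizerField {B : Submodule K L} [FiniteDimensional K B] {x : L} :
    x ∈ B.stabilizerField ↔ ∀ b ∈ B, x * b ∈ B :=
  Iff.rfl

/-- For `d ∈ E \ D` the subspace `Hd` of `E` meets `D` trivially, since `H` is closed under
inverses. -/
theorem finrank_add_finrank_le_of_stable (H : IntermediateField K L) {D E : Submodule K L}
    [FiniteDimensional K E] (hD : ∀ h ∈ H, ∀ d ∈ D, h * d ∈ D) (hE : ∀ h ∈ H, ∀ d ∈ E, h * d ∈ E)
    (hDE : D < E) : finrank K D + finrank K H ≤ finrank K E := by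
  obtain ⟨hle, d, hdE, hdD⟩ := SetLike.lt_iff_le_and_exists.1 hDE
  have hd0 : d ≠ 0 := by rintro rfl; exact hdD D.zero_mem
  let F : Submodule K L := (Subalgebra.toSubmodule H.toSubalgebra).map (LinearMap.mulRight K d)
  have hFE : F ≤ E := by
    rintro _ ⟨h, hh, rfl⟩
    exact hE h hh d hdE
  have hF : finrank K F = finrank K H :=
    (Submodule.equivMapOfInjective _ (LinearMap.mulRight_injective_of_ne_zero hd0)
      (Subalgebra.toSubmodule H.toSubalgebra)).finrank_eq.symm
  have hdisj : D ⊓ F = ⊥ := by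
    rw [eq_bot_iff]
    rintro _ ⟨hx, h, hh, rfl⟩
    rcases eq_or_ne h 0 with rfl | h0
    · simp
    · refine absurd ?_ hdD
      have := hD h⁻¹ (H.inv_mem hh) _ hx
      simpa [h0] using this
  have : FiniteDimensional K D := Submodule.finiteDimensional_of_le hle
  have : FiniteDimensional K F := Submodule.finiteDimensional_of_le hFE
  have h := Submodule.finrank_sup_add_finrank_inf_eq D F
  rw [hdisj, finrank_bot, add_zero, hF] at h
  rw [← h]
  exact Submodule.finrank_mono (sup_le hle hFE)

/-- The linear Dyson transform preserves the sum of the dimensions. -/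
theorem finrank_dyson_transform (A B : Submodule K L) [FiniteDimensional K A]
    [FiniteDimensional K B] {e : L} (he : e ≠ 0) :
    finrank K ↥(A ⊓ B.comap (LinearMap.mulRight K e)) +
      finrank K ↥(B ⊔ A.map (LinearMap.mulRight K e)) = finrank K A + finrank K B := by
  have hinj := LinearMap.mulRight_injective_of_ne_zero (K := K) he
  have h := Submodule.finrank_sup_add_finrank_inf_eq B (A.map (LinearMap.mulRight K e))
  have h1 : B ⊓ A.map (LinearMap.mulRight K e) =
      (A ⊓ B.comap (LinearMap.mulRight K e)).map (LinearMap.mulRight K e) := by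
    ext x
    constructor
    · rintro ⟨hx, y, hy, rfl⟩
      exact ⟨y, ⟨hy, hx⟩, rfl⟩
    · rintro ⟨y, ⟨hy, hx⟩, rfl⟩
      exact ⟨hx, y, hy, rfl⟩
  rw [h1, ← (Submodule.equivMapOfInjective _ hinj _).finrank_eq,
    ← (Submodule.equivMapOfInjective _ hinj A).finrank_eq] at h
  omega

/-- The case in which no Dyson transform shrinks `A`. -/
theorem exists_field_stable_between_of_stable (A B : Submodule K L) [FiniteDimensional K B]
    (hB : B ≠ ⊥) {a : L} (ha : a ∈ A) (ha0 : a ≠ 0) (h : ∀ e, a * e ∈ B → ∀ x ∈ A, x * e ∈ B) :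
    ∃ (H : IntermediateField K L) (D : Submodule K L), (∀ h ∈ H, ∀ d ∈ D, h * d ∈ D) ∧
      (∀ b ∈ B, a * b ∈ D) ∧ D ≤ A * B ∧ finrank K A + finrank K B ≤ finrank K D + finrank K H := by
  have hinj := LinearMap.mulRight_injective_of_ne_zero (K := K) ha0
  refine ⟨B.stabilizerField, B.map (LinearMap.mulRight K a), ?_, ?_, ?_, ?_⟩
  · rintro h hh _ ⟨b, hb, rfl⟩
    exact ⟨h * b, hh b hb, by simp [mul_assoc]⟩
  · exact fun b hb => ⟨b, hb, by simp [mul_comm]⟩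
  · rintro _ ⟨b, hb, rfl⟩
    simpa [mul_comm] using Submodule.mul_mem_mul ha hb
  · rw [← (Submodule.equivMapOfInjective _ hinj B).finrank_eq, add_comm]
    refine Nat.add_le_add_left ?_ _
    obtain ⟨b, hb, hb0⟩ := Submodule.exists_mem_ne_zero_of_ne_bot hB
    -- Multiplication by `b` embeds the stabilizer into `B`, so its `finrank` is its dimension.
    have hfin : FiniteDimensional K (Subalgebra.toSubmodule B.stabilizerField.toSubalgebra) := by
      have hle : (Subalgebra.toSubmodule B.stabilizerField.toSubalgebra).map
          (LinearMap.mulRight K b) ≤ B := by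
        rintro _ ⟨x, hx, rfl⟩
        exact hx b hb
      have := Submodule.finiteDimensional_of_le hle
      exact (Submodule.equivMapOfInjective _ (LinearMap.mulRight_injective_of_ne_zero hb0)
        _).symm.finiteDimensional
    have hle : A.map (LinearMap.mulRight K a⁻¹) ≤
        Subalgebra.toSubmodule B.stabilizerField.toSubalgebra := by
      rintro _ ⟨x, hx, rfl⟩ b hb
      simpa [mul_assoc] using h (a⁻¹ * b) (by simpa [ha0] using hb) x hx
    rw [(Submodule.equivMapOfInjective _
      (LinearMap.mulRight_injective_of_ne_zero (inv_ne_zero ha0)) A).finrank_eq]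
    exact Submodule.finrank_mono hle

/-- Every nonzero `a ∈ A` gives a subspace between `aB` and `AB` that satisfies the bound of
Kneser's theorem with respect to a field stabilising it. -/
theorem exists_field_stable_between (A B : Submodule K L) [FiniteDimensional K A]
    [FiniteDimensional K B] (hB : B ≠ ⊥) {a : L} (ha : a ∈ A) (ha0 : a ≠ 0) :
    ∃ (H : IntermediateField K L) (D : Submodule K L), (∀ h ∈ H, ∀ d ∈ D, h * d ∈ D) ∧
      (∀ b ∈ B, a * b ∈ D) ∧ D ≤ A * B ∧ finrank K A + finrank K B ≤ finrank K D + finrank K H := by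
  induction hn : finrank K A using Nat.strong_induction_on generalizing A B with
  | _ n ih =>
    subst hn
    by_cases h : ∀ e, a * e ∈ B → ∀ x ∈ A, x * e ∈ B
    · exact exists_field_stable_between_of_stable A B hB ha ha0 h
    · push Not at h
      obtain ⟨e, hae, x, hx, hxe⟩ := h
      have he0 : e ≠ 0 := by rintro rfl; simp at hxe
      let A' := A ⊓ B.comap (LinearMap.mulRight K e)
      let B' := B ⊔ A.map (LinearMap.mulRight K e)
      have hlt : A' < A := lt_of_le_of_ne inf_le_left fun heq => hxe (heq.ge hx).2
      have : FiniteDimensional K A' := Submodule.finiteDimensional_of_le hlt.le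
      obtain ⟨H, D, hD, haD, hDle, hdim⟩ := ih _ (Submodule.finrank_lt_finrank_of_lt hlt) A' B'
        (ne_bot_of_le_ne_bot hB le_sup_left) ⟨ha, hae⟩ rfl
      refine ⟨H, D, hD, fun b hb => haD b (le_sup_left (a := B) hb), hDle.trans ?_,
        (finrank_dyson_transform A B he0).symm.trans_le hdim⟩
      rw [Submodule.mul_sup]
      refine sup_le (mul_le_mul' hlt.le le_rfl) (Submodule.mul_le.2 ?_)
      rintro y hy _ ⟨z, hz, rfl⟩
      have h1 : y * (z * e) = z * (y * e) := by ring
      rw [LinearMap.mulRight_apply, h1]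
      exact Submodule.mul_mem_mul hz hy.2

theorem finrank_add_le_finrank_mul_mul (A B C : Submodule K L) [FiniteDimensional K A]
    [FiniteDimensional K B] [FiniteDimensional K C] (hB : B ≠ ⊥) (hC : (1 : L) ∈ C)
    (hne : A * B * C ≠ A * B) :
    finrank K A + finrank K B ≤ finrank K ↥(A * B * C) := by
  have hAB : A * B ≤ A * B * C := fun x hx => by
    simpa using Submodule.mul_mem_mul hx hC
  obtain ⟨a, ha, b, hb, c, hc, habc⟩ : ∃ a ∈ A, ∃ b ∈ B, ∃ c ∈ C, a * b * c ∉ A * B := by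
    by_contra! h
    refine hne (le_antisymm ?_ hAB)
    rw [mul_assoc]
    refine Submodule.mul_le.2 fun a ha y hy => ?_
    refine Submodule.mul_induction_on hy (fun b hb c hc => ?_) fun y z hy hz => ?_
    · rw [← mul_assoc]
      exact h a ha b hb c hc
    · rw [mul_add]
      exact Submodule.add_mem _ hy hz
  have ha0 : a ≠ 0 := by rintro rfl; simp at habc
  obtain ⟨H, D, hD, haD, hDle, hdim⟩ := exists_field_stable_between A B hB ha ha0
  have : FiniteDimensional K ↥(A * B * C) := Module.Finite.iff_fg.2
    (((Module.Finite.iff_fg.1 ‹_›).mul (Module.Finite.iff_fg.1 ‹_›)).mul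
      (Module.Finite.iff_fg.1 ‹_›))
  have hDC : D * C ≤ A * B * C := mul_le_mul' hDle le_rfl
  have : FiniteDimensional K ↥(D * C) := Submodule.finiteDimensional_of_le hDC
  have hlt : D < D * C := by
    refine SetLike.lt_iff_le_and_exists.2 ⟨fun x hx => ?_, a * b * c,
      Submodule.mul_mem_mul (haD b hb) hc, fun hmem => habc (hDle hmem)⟩
    simpa using Submodule.mul_mem_mul hx hC
  have hstable : ∀ h ∈ H, ∀ d ∈ D * C, h * d ∈ D * C := by
    intro h hh d hd
    refine Submodule.mul_induction_on hd (fun x hx y hy => ?_) fun x y hx hy => ?_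
    · rw [← mul_assoc]
      exact Submodule.mul_mem_mul (hD h hh x hx) hy
    · rw [mul_add]
      exact Submodule.add_mem _ hx hy
  exact hdim.trans ((finrank_add_finrank_le_of_stable H hD hstable hlt).trans
    (Submodule.finrank_mono hDC))

end

theorem mainTheorem5 {K L : Type*} [Field K] [Field L] [Algebra K L]
    (hsep : ∀ x : L, IsAlgebraic K x → IsSeparable K x)
    (A B C : Submodule K L)
    [FiniteDimensional K A] [FiniteDimensional K B] [FiniteDimensional K C]
    (hA : A ≠ ⊥) (hB : B ≠ ⊥) (hC : (1 : L) ∈ C) :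
    Submodule.span K ((A : Set L) * (B : Set L) * (C : Set L)) =
        Submodule.span K ((A : Set L) * (B : Set L)) ∨
      Module.finrank K A + Module.finrank K B ≤
        Module.finrank K (Submodule.span K ((A : Set L) * (B : Set L) * (C : Set L))) := by
  have h2 : Submodule.span K ((A : Set L) * (B : Set L)) = A * B :=
    (Submodule.mul_eq_span_mul_set A B).symm
  have h3 : Submodule.span K ((A : Set L) * (B : Set L) * (C : Set L)) = A * B * C := by
    rw [← Submodule.span_mul_span, h2, Submodule.span_eq]
  rw [h2, h3]
  exact or_iff_not_imp_left.2 (finrank_add_le_finrank_mul_mul A B C hB hC)
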